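/- Let $p$ be a prime number, let $F$ be a field, and let $G_F(p)$ be the maximal pro-$p$ quotient of the absolute Galois group $G_F=\mathrm{Gal}(F_{sep}/F)$. Let $S$ be a free pro-$p$ group on a set of (distinct) generators $\{x\}\cup\{y_i\mid i\in I\}$, where, if $I$ is infinite, the generators converge to $1$ (every neighbourhood of $1$ contains all but finitely many of them). Let $$1\longrightarrow R\longrightarrow S\stackrel{\pi}{\longrightarrow}G_F(p)\longrightarrow 1$$ be a minimal presentation of $G_F(p)$, that is, $\pi$ is a continuous surjective homomorphism whose kernel $R$ is contained in $S^p[S,S]$, the smallest closed subgroup of $S$ containing all $p$-th powers and all commutators. Let $[S,S]$ be the smallest closed subgroup of $S$ containing all commutators, and let $T$ be the closed subgroup of $S$ generated by $\{y_i\}_{i\in I}$. 1. Suppose that $F$ contains a primitive $p^m$-th root of unity for some $m\ge 2$. Then $R$ contains no element of the form $r=x^{p^l u}s$ with integers $l,u$ such that $1\le l<m$ and $\gcd(p,u)=1$, and with $s\in[S,S]T$. 2. Suppose that $F$ contains a primitive $p^n$-th root of unity for every $n\ge 1$. Then $R$ contains no element of the form $r=x^{p^l u}s$ with integers $l\ge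 1$ and $u\neq 0$, and with $s\in[S,S]T$. -/

import Mathlib

open Topology Filter
open scoped Pointwise

/-- A pro-`p` group: a profinite topological group all of whose open normal subgroups have
index a power of `p`. -/
structure IsProP (p : ℕ) (G : Type*) [Group G] [TopologicalSpace G] : Prop where
  isTopologicalGroup : IsTopologicalGroup G
  compactSpace : CompactSpace G
  totallyDisconnectedSpace : TotallyDisconnectedSpace G
  index_eq_pow : ∀ U : OpenNormalSubgroup G, ∃ n : ℕ, (U : Subgroup G).index = p ^ n

/-- `S` is a free pro-`p` group on the family `ι : X → S`. As usual for pro-`p` groups, the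
(possibly infinite) generating family converges to `1`: every neighbourhood of `1` contains all
but finitely many of its members. The universal property is stated for finite `p`-groups, of
which every pro-`p` group is a limit; every finite group is isomorphic to one in `Type`. The
uniqueness of the lifts says that the family generates `S` topologically. -/
structure IsFreeProP (p : ℕ) {X S : Type*} [Group S] [TopologicalSpace S] (ι : X → S) : Prop where
  isProP : IsProP p S
  tendsto_one : Tendsto ι cofinite (𝓝 1)
  existsUnique_lift : ∀ (Q : Type) [Group Q] [Finite Q] [TopologicalSpace Q] [DiscreteTopology Q],
    IsPGroup p Q → ∀ f : X → Q, {i | f i ≠ 1}.Finite →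
      ∃! φ : S →ₜ* Q, ∀ i, φ (ι i) = f i

/-- The kernel of the projection of a profinite group `G` onto its maximal pro-`p` quotient: the
intersection of all open normal subgroups of `p`-power index. -/
def maximalProPKernel (p : ℕ) (G : Type*) [Group G] [TopologicalSpace G] : Subgroup G :=
  ⨅ U : {U : OpenNormalSubgroup G // ∃ n : ℕ, (U : Subgroup G).index = p ^ n},
    ((U : OpenNormalSubgroup G) : Subgroup G)

instance maximalProPKernel_normal (p : ℕ) (G : Type*) [Group G] [TopologicalSpace G] :
    (maximalProPKernel p G).Normal :=
  Subgroup.normal_iInf_normal fun U => U.1.isNormal'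

/-- The maximal pro-`p` quotient of a profinite group, with the quotient topology. -/
abbrev MaximalProPQuotient (p : ℕ) (G : Type*) [Group G] [TopologicalSpace G] : Type _ :=
  G ⧸ maximalProPKernel p G

/-- `G_F(p)`: the maximal pro-`p` quotient of the absolute Galois group
`G_F = Gal(F_sep / F)` (with its Krull topology). -/
abbrev GaloisProP (p : ℕ) (F : Type*) [Field F] : Type _ :=
  MaximalProPQuotient p Gal(SeparableClosure F/F)

/-- The closed commutator subgroup `[S, S]`: the smallest closed subgroup containing all
commutators. -/
def closedCommutator (S : Type*) [Group S] [TopologicalSpace S] [IsTopologicalGroup S] :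
    Subgroup S :=
  (commutator S).topologicalClosure

/-- The closed subgroup generated by a family of elements. -/
def closedSubgroupGenerated {I S : Type*} [Group S] [TopologicalSpace S] [IsTopologicalGroup S]
    (y : I → S) : Subgroup S :=
  (Subgroup.closure (Set.range y)).topologicalClosure

/-- The closed subgroup `S^p [S, S]` (the Frattini subgroup if `S` is a pro-`p` group): the
smallest closed subgroup containing all `p`-th powers and all commutators. -/
def closedPowerCommutator (p : ℕ) (S : Type*) [Group S] [TopologicalSpace S]
    [IsTopologicalGroup S] : Subgroup S :=
  (Subgroup.closure (Set.range fun a : S => a ^ p) ⊔ commutator S).topologicalClosure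

/-- For a free pro-`p` group `S`, the sequence `1 → ker π → S → G → 1` is a minimal presentation
of `G`: `π` is onto and its kernel lies in `S^p [S, S]`. -/
structure IsMinimalPresentation (p : ℕ) {S G : Type*} [Group S] [TopologicalSpace S]
    [IsTopologicalGroup S] [Group G] [TopologicalSpace G] (π : S →ₜ* G) : Prop where
  surjective : Function.Surjective π
  ker_le : π.toMonoidHom.ker ≤ closedPowerCommutator p S

open Topology Filter
open scoped Pointwise

/-! When `F` contains a primitive `q`-th root of unity, `q = p ^ (m + 1)`, every continuous
character `φ : S → μ_q(F)` kills `R = ker π`. Indeed `φ ^ p ^ m` has order dividing `p`, so by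
minimality it descends to `G_F(p)`, where Kummer theory makes it `ψ ^ p ^ m`
(`exists_character_pow_eq`). The quotient of `φ` by the inflation of `ψ` is killed by `p ^ m`, so
freeness makes it a `p`-th power `φ' ^ p`, and `φ = φ' ^ p` on `R`. Iterating `m + 1` times gives `φ
= 1` on `R`. The character `x ↦ ζ`, `y i ↦ 1` then forces `q ∣ N` whenever `x ^ N * s ∈ R`. -/

section OpenKernel

variable {G H M : Type*} [Group G] [TopologicalSpace G] [Group H] [TopologicalSpace H]

theorem isOpen_ker_mul [SeparatelyContinuousMul G] [CommGroup M] {φ ψ : G →* M}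
    (hφ : IsOpen (φ.ker : Set G)) (hψ : IsOpen (ψ.ker : Set G)) :
    IsOpen ((φ * ψ).ker : Set G) := by
  refine Subgroup.isOpen_mono (H₁ := φ.ker ⊓ ψ.ker) (fun g hg => ?_) (hφ.inter hψ)
  obtain ⟨h1, h2⟩ := hg
  have h1 : φ g = 1 := h1
  have h2 : ψ g = 1 := h2
  simp [MonoidHom.mem_ker, h1, h2]

theorem isOpen_ker_pow [SeparatelyContinuousMul G] [CommGroup M] {φ : G →* M}
    (hφ : IsOpen (φ.ker : Set G)) (n : ℕ) : IsOpen ((φ ^ n).ker : Set G) := by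
  refine Subgroup.isOpen_mono (H₁ := φ.ker) (fun g hg => ?_) hφ
  have hg : φ g = 1 := hg
  simp [MonoidHom.mem_ker, hg]

theorem isOpen_ker_inv [SeparatelyContinuousMul G] [CommGroup M] {φ : G →* M}
    (hφ : IsOpen (φ.ker : Set G)) : IsOpen ((φ⁻¹).ker : Set G) := by
  refine Subgroup.isOpen_mono (H₁ := φ.ker) (fun g hg => ?_) hφ
  have hg : φ g = 1 := hg
  simp [MonoidHom.mem_ker, hg]

theorem isOpen_ker_comp [Group M] {φ : H →* M} (hφ : IsOpen (φ.ker : Set H)) {f : G →* H}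
    (hf : Continuous f) : IsOpen ((φ.comp f).ker : Set G) :=
  hφ.preimage hf

/-- Homomorphisms with open kernel descend along topological quotient maps. -/
theorem exists_comp_eq_isOpen_ker [Group M] {f : G →* H} (hf : IsQuotientMap f) {φ : G →* M}
    (hφ : IsOpen (φ.ker : Set G)) (hle : f.ker ≤ φ.ker) :
    ∃ ψ : H →* M, ψ.comp f = φ ∧ IsOpen (ψ.ker : Set H) := by
  have h : (f.liftOfSurjective hf.surjective ⟨φ, hle⟩).comp f = φ :=
    f.liftOfRightInverse_comp _ (Function.rightInverse_surjInv hf.surjective) ⟨φ, hle⟩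
  refine ⟨f.liftOfSurjective hf.surjective ⟨φ, hle⟩, h, ?_⟩
  rw [← hf.isOpen_preimage]
  convert hφ using 1
  ext g
  exact iff_of_eq (congrArg (· = 1) (DFunLike.congr_fun h g))

end OpenKernel

/-! ### Characters and the maximal pro-`p` quotient -/

section ProP

variable {p : ℕ} {G M : Type*} [Group G] [TopologicalSpace G] [IsTopologicalGroup G]

theorem isClosed_maximalProPKernel (p : ℕ) (G : Type*) [Group G] [TopologicalSpace G]
    [IsTopologicalGroup G] : IsClosed (maximalProPKernel p G : Set G) := by
  rw [maximalProPKernel, Subgroup.coe_iInf]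
  exact isClosed_iInter fun U => U.1.toOpenSubgroup.isClosed

instance (p : ℕ) (G : Type*) [Group G] [TopologicalSpace G] [IsTopologicalGroup G] :
    T2Space (MaximalProPQuotient p G) :=
  have := isClosed_maximalProPKernel p G
  inferInstance

/-- By compactness `G ⧸ φ.ker` is finite, and its exponent is a power of `p`, so `φ.ker` is one of
the subgroups being intersected. -/
theorem maximalProPKernel_le_ker [CompactSpace G] [Group M] (hp : p.Prime) {φ : G →* M}
    (hφ : IsOpen (φ.ker : Set G)) {m : ℕ} (hm : ∀ g, φ g ^ p ^ m = 1) :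
    maximalProPKernel p G ≤ φ.ker := by
  have := Fact.mk hp
  have : Finite (G ⧸ φ.ker) := φ.ker.quotient_finite_of_isOpen hφ
  have hpg : IsPGroup p (G ⧸ φ.ker) := fun q => by
    obtain ⟨g, rfl⟩ := QuotientGroup.mk_surjective q
    refine ⟨m, ?_⟩
    rw [← QuotientGroup.mk_pow, QuotientGroup.eq_one_iff, MonoidHom.mem_ker, map_pow, hm]
  obtain ⟨n, hn⟩ := IsPGroup.iff_card.mp hpg
  exact iInf_le (fun U : {U : OpenNormalSubgroup G // ∃ n : ℕ, (U : Subgroup G).index = p ^ n} =>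
    ((U : OpenNormalSubgroup G) : Subgroup G)) ⟨⟨⟨φ.ker, hφ⟩, inferInstance⟩, n, hn⟩

theorem closedPowerCommutator_le_ker [CommGroup M] {φ : G →* M} (hφ : IsOpen (φ.ker : Set G))
    (h : φ ^ p = 1) : closedPowerCommutator p G ≤ φ.ker := by
  refine Subgroup.topologicalClosure_minimal _ (sup_le ?_ (Abelianization.commutator_subset_ker φ))
    (φ.ker.isClosed_of_isOpen hφ)
  rw [Subgroup.closure_le]
  rintro _ ⟨g, rfl⟩
  simpa [MonoidHom.mem_ker] using DFunLike.congr_fun h g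

end ProP

/-! ### Kummer theory for characters of the Galois group -/

section Kummer

variable {F L : Type*} [Field F] [Field L] [Algebra F L] [IsGalois F L]

/-- Hilbert 90 for characters with values in the base field: each has an eigenvector. -/
theorem exists_ne_zero_forall_eq_mul (χ : Gal(L/F) →* Fˣ) (hχ : IsOpen (χ.ker : Set Gal(L/F))) :
    ∃ a : L, a ≠ 0 ∧ ∀ σ : Gal(L/F), σ a = algebraMap F L (χ σ) * a := by
  have : Finite (Gal(L/F) ⧸ χ.ker) := χ.ker.quotient_finite_of_isOpen hχ
  have : Finite χ.range := .of_equiv _ (QuotientGroup.quotientKerEquivRange χ).toEquiv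
  have := Fintype.ofFinite χ.range
  let K := IntermediateField.fixedField χ.ker
  have hK : K.fixingSubgroup = χ.ker :=
    InfiniteGalois.fixingSubgroup_fixedField ⟨χ.ker, χ.ker.isClosed_of_isOpen hχ⟩
  choose s hs using fun i : χ.range => i.2
  have hsK : ∀ (σ τ : Gal(L/F)), χ σ = χ τ ↔ ∀ c : K, σ c = τ c := fun σ τ => by
    have : χ σ = χ τ ↔ τ⁻¹ * σ ∈ K.fixingSubgroup := by
      rw [hK, MonoidHom.mem_ker, map_mul, map_inv, inv_mul_eq_one, eq_comm]
    rw [this, IntermediateField.mem_fixingSubgroup_iff, Subtype.forall]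
    refine forall₂_congr fun c _ => ?_
    rw [AlgEquiv.mul_apply, AlgEquiv.aut_inv, AlgEquiv.symm_apply_eq]
  -- Distinct values of `χ` give distinct embeddings of `K`; their independence (Dedekind) yields a
  -- nonzero Lagrange resolvent, the eigenvector sought.
  let f : χ.range → K →* L := fun i => ((s i : L ≃ₐ[F] L) : L →* L).comp (algebraMap K L)
  have hf : Function.Injective f := fun i j hij => by
    rw [Subtype.ext_iff, ← hs i, ← hs j, hsK]
    exact fun c => DFunLike.congr_fun hij c
  have hli := (linearIndependent_monoidHom K L).comp f hf
  rw [Fintype.linearIndependent_iff] at hli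
  obtain ⟨c, hc⟩ : ∃ c : K, ∑ i : χ.range, algebraMap F L ((i : Fˣ)⁻¹ : Fˣ) * s i c ≠ 0 := by
    by_contra! h
    refine absurd (hli (fun i => algebraMap F L ((i : Fˣ)⁻¹ : Fˣ)) ?_ 1) (by simp)
    ext c
    rw [Finset.sum_apply]
    exact h c
  refine ⟨_, hc, fun σ => ?_⟩
  rw [map_sum, Finset.mul_sum]
  refine Fintype.sum_equiv (Equiv.mulLeft ⟨χ σ, σ, rfl⟩) _ _ fun i => ?_
  have h1 : σ (s i c) = s (⟨χ σ, σ, rfl⟩ * i) c :=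
    (hsK (σ * s i) _).mp (by rw [map_mul, hs, hs]; rfl) c
  rw [map_mul, AlgEquiv.commutes, h1, ← mul_assoc, ← map_mul, ← Units.val_mul]
  simp

/-- The Kummer character of an element whose `n`-th power is fixed. -/
theorem exists_kummerCharacter {n : ℕ} [NeZero n] {ζ : F} (hζ : IsPrimitiveRoot ζ n) {b : L}
    (hb : b ≠ 0) (h : ∀ σ : Gal(L/F), σ b ^ n = b ^ n) :
    ∃ ψ : Gal(L/F) →* Fˣ, IsOpen (ψ.ker : Set Gal(L/F)) ∧ (∀ σ, ψ σ ^ n = 1) ∧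
      ∀ σ : Gal(L/F), σ b = algebraMap F L (ψ σ) * b := by
  have hex : ∀ σ : Gal(L/F), ∃ z : Fˣ, z ^ n = 1 ∧ σ b = algebraMap F L z * b := fun σ => by
    obtain ⟨i, -, hi⟩ := (hζ.map_of_injective (algebraMap F L).injective).eq_pow_of_pow_eq_one
      (ξ := σ b / b) (by rw [div_pow, h, div_self (pow_ne_zero n hb)])
    refine ⟨hζ.toRootsOfUnity ^ i, ?_, ?_⟩
    · rw [← pow_mul, mul_comm, pow_mul, (mem_rootsOfUnity _ _).mp hζ.toRootsOfUnity.2, one_pow]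
    · rw [← div_eq_iff hb, ← hi]
      simp
  choose ψ hψn hψ using hex
  have hinj : ∀ z w : Fˣ, algebraMap F L z * b = algebraMap F L w * b → z = w := fun z w hzw =>
    Units.ext ((algebraMap F L).injective (mul_right_cancel₀ hb hzw))
  refine ⟨MonoidHom.mk' ψ fun σ τ => hinj _ _ ?_, ?_, hψn, hψ⟩
  · rw [← hψ, AlgEquiv.mul_apply, hψ τ, map_mul, AlgEquiv.commutes, hψ σ, Units.val_mul, map_mul]
    ring
  -- The kernel is the stabilizer of the algebraic element `b`.
  · convert stabilizer_isOpen_of_isIntegral (K := F) b using 1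
    ext σ
    change ψ σ = 1 ↔ σ b = b
    rw [hψ]
    exact ⟨fun h => by simp [h], fun h => hinj _ _ (by simpa using h)⟩

/-- If `F` contains a primitive `p ^ m`-th root of unity, every character of `G_F(p)` of order
dividing `p` is the `p ^ (m - 1)`-th power of a character of order dividing `p ^ m`. -/
theorem exists_character_pow_eq {p : ℕ} (hp : p.Prime) {m : ℕ} {ζ : F}
    (hζ : IsPrimitiveRoot ζ (p ^ (m + 1))) (χ : GaloisProP p F →* Fˣ)
    (hχ : IsOpen (χ.ker : Set (GaloisProP p F))) (hχp : χ ^ p = 1) :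
    ∃ ψ : GaloisProP p F →* Fˣ, IsOpen (ψ.ker : Set (GaloisProP p F)) ∧
      (∀ σ, ψ σ ^ p ^ (m + 1) = 1) ∧ ψ ^ p ^ m = χ := by
  have : NeZero p := ⟨hp.ne_zero⟩
  let q := QuotientGroup.mk' (maximalProPKernel p Gal(SeparableClosure F/F))
  have hq : IsQuotientMap q := QuotientGroup.isQuotientMap_mk _
  obtain ⟨a, ha, hχa⟩ :=
    exists_ne_zero_forall_eq_mul (χ.comp q) (isOpen_ker_comp hχ hq.continuous)
  have hpF : NeZero ((p ^ m : ℕ) : SeparableClosure F) := by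
    have h := (hζ.map_of_injective (algebraMap F (SeparableClosure F)).injective).neZero'
    refine ⟨fun h0 => h.out ?_⟩
    rw [pow_succ, Nat.cast_mul, h0, zero_mul]
  -- The Kummer character of `b` works: `b ^ p ^ (m + 1) = a ^ p` is Galois-fixed, and its `p ^
  -- m`-th power is the character of `a`, namely `χ`.
  obtain ⟨b, hb⟩ := IsSepClosed.exists_pow_nat_eq a (p ^ m)
  have hb0 : b ≠ 0 := by
    rintro rfl
    exact ha (by rw [← hb, zero_pow (NeZero.ne _)])
  have hap : ∀ σ : Gal(SeparableClosure F/F), σ a ^ p = a ^ p := fun σ => by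
    have h1 : (χ (q σ)) ^ p = 1 := DFunLike.congr_fun hχp (q σ)
    rw [hχa, mul_pow, ← map_pow, MonoidHom.comp_apply, ← Units.val_pow_eq_pow_val, h1]
    simp
  obtain ⟨ψ, hψ, hψn, hψb⟩ := exists_kummerCharacter hζ hb0 fun σ => by
    rw [pow_succ, pow_mul, pow_mul, ← map_pow, hb, hap]
  obtain ⟨ψ', hψ', hψ'o⟩ := exists_comp_eq_isOpen_ker hq hψ (by
    rw [QuotientGroup.ker_mk']
    exact maximalProPKernel_le_ker hp hψ hψn)
  refine ⟨ψ', hψ'o, fun g => ?_, MonoidHom.ext fun g => ?_⟩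
  · obtain ⟨σ, rfl⟩ := hq.surjective g
    rw [← hψn σ, ← hψ']
    rfl
  · obtain ⟨σ, rfl⟩ := hq.surjective g
    have h1 : ψ' (q σ) = ψ σ := DFunLike.congr_fun hψ' σ
    rw [MonoidHom.pow_apply, h1]
    refine Units.ext ((algebraMap F (SeparableClosure F)).injective (mul_right_cancel₀ ha ?_))
    rw [Units.val_pow_eq_pow_val, map_pow]
    nth_rw 1 [← hb]
    rw [← mul_pow, ← hψb, ← map_pow, hb, hχa]
    rfl

end Kummer

/-! ### Lifting and uniqueness for free pro-`p` groups -/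

namespace IsFreeProP

variable {p : ℕ} {X S : Type*} [Group S] [TopologicalSpace S] {ι : X → S}

theorem exists_lift (h : IsFreeProP p ι) {Q : Type*} [Group Q] [Finite Q] (hQ : IsPGroup p Q)
    (f : X → Q) (hf : {i | f i ≠ 1}.Finite) :
    ∃ φ : S →* Q, IsOpen (φ.ker : Set S) ∧ ∀ i, φ (ι i) = f i := by
  obtain ⟨Q', _, _, ⟨e⟩⟩ := Finite.exists_type_univ_nonempty_mulEquiv Q
  let _ : TopologicalSpace Q' := ⊥
  have : DiscreteTopology Q' := ⟨rfl⟩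
  obtain ⟨φ, hφ, -⟩ := h.existsUnique_lift Q' (hQ.of_equiv e) (fun i => e (f i)) (by simpa using hf)
  refine ⟨e.symm.toMonoidHom.comp φ.toMonoidHom, ?_, fun i => ?_⟩
  · convert (isOpen_discrete ({1} : Set Q')).preimage φ.continuous_toFun using 1
    ext g
    simp [MonoidHom.mem_ker]
  · rw [MonoidHom.comp_apply]
    exact (congrArg e.symm (hφ i)).trans (e.symm_apply_apply _)

/-- The image of `φ` is a finite `p`-group, so uniqueness of lifts applies to a copy of `S ⧸ φ.ker`
in `Type`. -/
theorem eq_one_of_forall (h : IsFreeProP p ι) {M : Type*} [Group M] {φ : S →* M}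
    (hφ : IsOpen (φ.ker : Set S)) (h1 : ∀ i, φ (ι i) = 1) : φ = 1 := by
  have := h.isProP.isTopologicalGroup
  have := h.isProP.compactSpace
  have : Finite (S ⧸ φ.ker) := φ.ker.quotient_finite_of_isOpen hφ
  obtain ⟨n, hn⟩ := h.isProP.index_eq_pow ⟨⟨φ.ker, hφ⟩, inferInstance⟩
  have hpg : IsPGroup p (S ⧸ φ.ker) := IsPGroup.of_card hn
  obtain ⟨Q, _, _, ⟨e⟩⟩ := Finite.exists_type_univ_nonempty_mulEquiv (S ⧸ φ.ker)
  let _ : TopologicalSpace Q := ⊥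
  have : DiscreteTopology Q := ⟨rfl⟩
  let θ : S →* Q := e.toMonoidHom.comp (QuotientGroup.mk' φ.ker)
  have hθ : ∀ s, θ s = 1 ↔ φ s = 1 := fun s => by
    change e (QuotientGroup.mk' φ.ker s) = 1 ↔ _
    rw [EmbeddingLike.map_eq_one_iff, QuotientGroup.mk'_apply, QuotientGroup.eq_one_iff,
      MonoidHom.mem_ker]
  have hθc : Continuous θ := continuous_of_continuousAt_one θ <| by
    rw [ContinuousAt, map_one, nhds_discrete Q, tendsto_pure]
    filter_upwards [hφ.mem_nhds (one_mem φ.ker)] with s hs using (hθ s).mpr hs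
  have heq := (h.existsUnique_lift Q (hpg.of_equiv e) 1 (by simp)).unique
    (y₁ := ⟨θ, hθc⟩) (y₂ := 1) (fun i => (hθ _).mpr (h1 i)) (fun i => rfl)
  exact MonoidHom.ext fun s => (hθ s).mp (DFunLike.congr_fun heq s)

theorem finite_setOf_apply_ne_one (h : IsFreeProP p ι) {M : Type*} [Group M] {φ : S →* M}
    (hφ : IsOpen (φ.ker : Set S)) : {i | φ (ι i) ≠ 1}.Finite :=
  h.tendsto_one (hφ.mem_nhds (one_mem φ.ker))

end IsFreeProP

/-! ### Roots of unity of `p`-power order -/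

section Roots

variable {p : ℕ} {F : Type*} [Field F]

theorem isPGroup_rootsOfUnity (p n : ℕ) (F : Type*) [Field F] :
    IsPGroup p (rootsOfUnity (p ^ n) F) := fun g => ⟨n, Subtype.ext g.2⟩

theorem exists_pow_eq_of_isPrimitiveRoot (hp : p.Prime) {m : ℕ} {ζ : F}
    (hζ : IsPrimitiveRoot ζ (p ^ (m + 1))) {z : Fˣ} (hz : z ^ p ^ m = 1) :
    ∃ w : rootsOfUnity (p ^ (m + 1)) F, (w : Fˣ) ^ p = z := by
  have : NeZero p := ⟨hp.ne_zero⟩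
  have hz' : (z : F) ^ p ^ m = 1 := by rw [← Units.val_pow_eq_pow_val, hz, Units.val_one]
  obtain ⟨i, -, hi⟩ := (hζ.pow (NeZero.pos _) (pow_succ' p m)).eq_pow_of_pow_eq_one hz'
  refine ⟨hζ.toRootsOfUnity ^ i, Units.ext ?_⟩
  rw [← hi]
  simp [← pow_mul, mul_comm]

end Roots

/-! ### Characters of a minimal presentation -/

section Presentation

variable {p : ℕ} {F : Type*} [Field F] {S : Type*} [Group S] [TopologicalSpace S]
  [IsTopologicalGroup S] {X : Type*} {ι : X → S} {π : S →ₜ* GaloisProP p F}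

/-- Modulo characters inflated from `G_F(p)`, every character of order dividing `p ^ (m + 1)` of a
minimal presentation is a `p`-th power. -/
theorem exists_character_eq_pow_on_ker (hp : p.Prime) (hfree : IsFreeProP p ι)
    (hπ : IsMinimalPresentation p π) {m : ℕ} {ζ : F} (hζ : IsPrimitiveRoot ζ (p ^ (m + 1)))
    {φ : S →* Fˣ} (hφ : IsOpen (φ.ker : Set S)) (hφm : ∀ s, φ s ^ p ^ (m + 1) = 1) :
    ∃ φ' : S →* Fˣ, IsOpen (φ'.ker : Set S) ∧ (∀ s, φ' s ^ p ^ (m + 1) = 1) ∧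
      ∀ r ∈ π.toMonoidHom.ker, φ r = φ' r ^ p := by
  have : NeZero p := ⟨hp.ne_zero⟩
  have := hfree.isProP.compactSpace
  -- A continuous map from a compact space to a Hausdorff one is closed.
  have hπq : IsQuotientMap π.toMonoidHom :=
    π.continuous_toFun.isClosedMap.isQuotientMap π.continuous_toFun hπ.surjective
  have hφp : (φ ^ p ^ m) ^ p = 1 := MonoidHom.ext fun s => by
    rw [MonoidHom.pow_apply, MonoidHom.pow_apply, ← pow_mul, ← pow_succ]
    exact hφm s
  have hφo := isOpen_ker_pow hφ (p ^ m)
  obtain ⟨χ, hχ, hχo⟩ := exists_comp_eq_isOpen_ker hπq hφo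
    (hπ.ker_le.trans (closedPowerCommutator_le_ker hφo hφp))
  obtain ⟨ψ, hψo, hψm, hψ⟩ := exists_character_pow_eq hp hζ χ hχo <| MonoidHom.ext fun g => by
    obtain ⟨s, rfl⟩ := hπq.surjective g
    exact (congrArg (· ^ p) (DFunLike.congr_fun hχ s)).trans (DFunLike.congr_fun hφp s)
  let δ : S →* Fˣ := φ * (ψ.comp π.toMonoidHom)⁻¹
  have hδ : IsOpen (δ.ker : Set S) :=
    isOpen_ker_mul hφ (isOpen_ker_inv (isOpen_ker_comp hψo π.continuous_toFun))
  have hδm : ∀ s, δ s ^ p ^ m = 1 := fun s => by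
    change (φ s * (ψ (π.toMonoidHom s))⁻¹) ^ p ^ m = 1
    have h1 : ψ (π.toMonoidHom s) ^ p ^ m = χ (π.toMonoidHom s) := DFunLike.congr_fun hψ _
    have h2 : χ (π.toMonoidHom s) = φ s ^ p ^ m := DFunLike.congr_fun hχ s
    rw [mul_pow, inv_pow, h1, h2, mul_inv_cancel]
  -- Choosing the root `1` wherever `δ (ι i) = 1` leaves only finitely many nontrivial values, as
  -- lifting requires.
  have hroot : ∀ i, ∃ w : rootsOfUnity (p ^ (m + 1)) F,
      (w : Fˣ) ^ p = δ (ι i) ∧ (δ (ι i) = 1 → w = 1) := fun i => by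
    by_cases h : δ (ι i) = 1
    · exact ⟨1, by simp [h], fun _ => rfl⟩
    · obtain ⟨w, hw⟩ := exists_pow_eq_of_isPrimitiveRoot hp hζ (hδm (ι i))
      exact ⟨w, hw, fun h' => absurd h' h⟩
  choose w hw hw1 using hroot
  obtain ⟨θ, hθ, hθw⟩ := hfree.exists_lift (isPGroup_rootsOfUnity p (m + 1) F) w
    ((hfree.finite_setOf_apply_ne_one hδ).subset fun i hi h => hi (hw1 i h))
  let φ' : S →* Fˣ := (rootsOfUnity (p ^ (m + 1)) F).subtype.comp θ
  have hφ' : IsOpen (φ'.ker : Set S) := by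
    refine Subgroup.isOpen_mono (H₁ := θ.ker) (fun s hs => ?_) hθ
    rw [MonoidHom.mem_ker] at hs ⊢
    simp [φ', hs]
  refine ⟨φ', hφ', fun s => (θ s).2, fun r hr => ?_⟩
  have hone : δ * (φ' ^ p)⁻¹ = 1 := by
    refine hfree.eq_one_of_forall (isOpen_ker_mul hδ (isOpen_ker_inv (isOpen_ker_pow hφ' p)))
      fun i => ?_
    change δ (ι i) * ((θ (ι i) : Fˣ) ^ p)⁻¹ = 1
    rw [hθw, hw, mul_inv_cancel]
  have h1 : φ r * (ψ (π.toMonoidHom r))⁻¹ * (φ' r ^ p)⁻¹ = 1 := DFunLike.congr_fun hone r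
  rw [MonoidHom.mem_ker.mp hr, map_one, inv_one, mul_one] at h1
  exact mul_inv_eq_one.mp h1

/-- If `F` contains a primitive `p ^ (m + 1)`-th root of unity, characters of order dividing
`p ^ (m + 1)` of a minimal presentation of `G_F(p)` are inflated from `G_F(p)`. -/
theorem ker_le_ker_of_isMinimalPresentation (hp : p.Prime) (hfree : IsFreeProP p ι)
    (hπ : IsMinimalPresentation p π) {m : ℕ} {ζ : F} (hζ : IsPrimitiveRoot ζ (p ^ (m + 1)))
    {φ : S →* Fˣ} (hφ : IsOpen (φ.ker : Set S)) (hφm : ∀ s, φ s ^ p ^ (m + 1) = 1) :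
    π.toMonoidHom.ker ≤ φ.ker := by
  have key : ∀ k : ℕ, ∃ φ' : S →* Fˣ, IsOpen (φ'.ker : Set S) ∧
      (∀ s, φ' s ^ p ^ (m + 1) = 1) ∧ ∀ r ∈ π.toMonoidHom.ker, φ r = φ' r ^ p ^ k := fun k => by
    induction k with
    | zero => exact ⟨φ, hφ, hφm, fun r _ => by simp⟩
    | succ k ih =>
      obtain ⟨φ₁, h₁, h₁m, h₁r⟩ := ih
      obtain ⟨φ₂, h₂, h₂m, h₂r⟩ := exists_character_eq_pow_on_ker hp hfree hπ hζ h₁ h₁m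
      exact ⟨φ₂, h₂, h₂m, fun r hr => by rw [h₁r r hr, h₂r r hr, ← pow_mul, ← pow_succ']⟩
  obtain ⟨φ', -, h, hr⟩ := key (m + 1)
  exact fun r hrk => (hr r hrk).trans (h r)

theorem pow_dvd_of_zpow_mul_mem_ker (hp : p.Prime) {I : Type*} {x : S} {y : I → S}
    (hfree : IsFreeProP p (fun o : Option I => o.elim x y)) (hπ : IsMinimalPresentation p π)
    {m : ℕ} {ζ : F} (hζ : IsPrimitiveRoot ζ (p ^ m)) {N : ℤ} {s : S}
    (hs : s ∈ (closedCommutator S : Set S) * (closedSubgroupGenerated y : Set S))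
    (h : x ^ N * s ∈ π.toMonoidHom.ker) : ((p ^ m : ℕ) : ℤ) ∣ N := by
  obtain _ | m := m
  · simp
  have : NeZero p := ⟨hp.ne_zero⟩
  obtain ⟨θ, hθ, hθι⟩ := hfree.exists_lift (isPGroup_rootsOfUnity p (m + 1) F)
    (fun o : Option I => o.elim hζ.toRootsOfUnity fun _ => 1)
    ((Set.finite_singleton none).subset fun o ho => by cases o <;> simp_all)
  let φ : S →* Fˣ := (rootsOfUnity (p ^ (m + 1)) F).subtype.comp θ
  have hφ : IsOpen (φ.ker : Set S) := by
    refine Subgroup.isOpen_mono (H₁ := θ.ker) (fun s hs => ?_) hθ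
    rw [MonoidHom.mem_ker] at hs ⊢
    simp [φ, hs]
  have hφr : φ (x ^ N * s) = 1 :=
    ker_le_ker_of_isMinimalPresentation hp hfree hπ hζ hφ (fun s => (θ s).2) h
  have hcl := φ.ker.isClosed_of_isOpen hφ
  obtain ⟨c, hc, t, ht, rfl⟩ := hs
  have hc1 : φ c = 1 :=
    Subgroup.topologicalClosure_minimal _ (Abelianization.commutator_subset_ker φ) hcl hc
  have ht1 : φ t = 1 := by
    refine Subgroup.topologicalClosure_minimal (t := φ.ker) _ ?_ hcl ht
    rw [Subgroup.closure_le]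
    rintro _ ⟨i, rfl⟩
    exact congrArg Subtype.val (hθι (some i))
  have hx : φ x = hζ.toRootsOfUnity := congrArg Subtype.val (hθι none)
  simp only [map_mul, map_zpow, hc1, ht1, hx, mul_one] at hφr
  rw [← hζ.zpow_eq_one_iff_dvd]
  simpa using congrArg Units.val hφr

end Presentation

theorem theorem3p4 (p : ℕ) (hp : p.Prime) {F : Type*} [Field F]
    {S : Type*} [Group S] [TopologicalSpace S] [IsTopologicalGroup S]
    {I : Type*} (x : S) (y : I → S)
    (hfree : IsFreeProP p (fun o : Option I => o.elim x y))
    (π : S →ₜ* GaloisProP p F) (hπ : IsMinimalPresentation p π) :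
    (∀ m : ℕ, 2 ≤ m → (∃ ζ : F, IsPrimitiveRoot ζ (p ^ m)) →
      ∀ (l : ℕ) (u : ℤ), 1 ≤ l → l < m → IsCoprime (p : ℤ) u →
        ∀ s ∈ (closedCommutator S : Set S) * (closedSubgroupGenerated y : Set S),
          x ^ ((p : ℤ) ^ l * u) * s ∉ π.toMonoidHom.ker) ∧
    ((∀ n : ℕ, ∃ ζ : F, IsPrimitiveRoot ζ (p ^ n)) →
      ∀ (l : ℕ) (u : ℤ), 1 ≤ l → u ≠ 0 →
        ∀ s ∈ (closedCommutator S : Set S) * (closedSubgroupGenerated y : Set S),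
          x ^ ((p : ℤ) ^ l * u) * s ∉ π.toMonoidHom.ker) := by
  have hp0 : (p : ℤ) ≠ 0 := mod_cast hp.ne_zero
  refine ⟨fun m _ ⟨ζ, hζ⟩ l u _ hlm hu s hs h => ?_, fun hroots l u _ hu s hs h => ?_⟩
  · have hdvd := pow_dvd_of_zpow_mul_mem_ker hp hfree hπ hζ hs h
    have hdvd' : (p : ℤ) ^ l * p ∣ (p : ℤ) ^ l * u := by
      rw [← pow_succ]
      refine (pow_dvd_pow _ hlm).trans ?_
      exact_mod_cast hdvd
    have hpu := (mul_dvd_mul_iff_left (pow_ne_zero l hp0)).mp hdvd'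
    exact (Nat.prime_iff_prime_int.mp hp).not_isUnit (hu.isUnit_of_dvd' dvd_rfl hpu)
  · set N := (p : ℤ) ^ l * u with hN
    have hN0 : N ≠ 0 := mul_ne_zero (pow_ne_zero l hp0) hu
    obtain ⟨ζ, hζ⟩ := hroots N.natAbs
    have hdvd := pow_dvd_of_zpow_mul_mem_ker hp hfree hπ hζ hs h
    -- The exponent `|N|` is large enough, since `|N| < p ^ |N|`.
    exact (Nat.lt_pow_self hp.one_lt).not_ge
      (Nat.le_of_dvd (Int.natAbs_pos.mpr hN0) (Int.natCast_dvd.mp hdvd))
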